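/- **Completeness of $LS_{PASL}$.** Formulae are built from propositional variables $p$ by $$A ::= p \mid \top \mid \bot \mid \top^* \mid A\land A \mid A\to A \mid A * A \mid A \mathbin{-\!*} A .$$ A *separation algebra* is a partial cancellative commutative monoid $(H,\circ,\epsilon)$: $\circ$ is a partial binary operation on $H$ and $\epsilon\in H$, with $h\circ\epsilon=h$, $h_1\circ h_2=h_2\circ h_1$, $(h_1\circ h_2)\circ h_3=h_1\circ(h_2\circ h_3)$ (both sides undefined, or both defined and equal), and $h_1\circ h_2=h_1\circ h_3$ defined implies $h_2=h_3$. For a valuation $v$ of the variables by subsets of $H$: $h\Vdash p$ iff $h\in v(p)$; $\top,\bot,\land,\to$ are classical; $h\Vdash\top^*$ iff $h=\epsilon$; $h\Vdash A*B$ iff $h=h_1\circ h_2$ for some $h_1\Vdash A$, $h_2\Vdash B$; $h\Vdash A\mathbin{-\!*}B$ iff for every $h_1\Vdash A$ with $h_1\circ h$ defined, $h_1\circ h\Vdash B$. A formula is *PASL-valid* if it holds at every $h$, for every separation algebra and every valuation. *Labels* are the constant $\epsilon$ and countably infinitely many label variables. *Relational atoms* are $(x,y\triangleright z)$, $x=y$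 and $x\neq y$ for labels $x,y,z$. A *sequent* $\mathcal G;\Gamma\vdash\Delta$ consists of a finite set $\mathcal G$ of relational atoms and finite sets $\Gamma,\Delta$ of labelled formulae $w:A$; the semicolon denotes union. $E(\mathcal G)\vdash x=y$ means that $(x,y)$ is in the smallest equivalence relation on labels containing all equality atoms of $\mathcal G$. The calculus $LS_{PASL}$ has the following rules (conclusion from premises) and no cut rule: - $id$: $\mathcal G;\Gamma;w:p\vdash w':p;\Delta$ if $E(\mathcal G)\vdash w=w'$. $\quad\bot L$: $\mathcal G;\Gamma;w:\bot\vdash\Delta$. $\quad\top R$: $\mathcal G;\Gamma\vdash w:\top;\Delta$. - $\top^*L$: $\mathcal G;\Gamma;w:\top^*\vdash\Delta$ from $\mathcal G;w=\epsilon;\Gamma\vdash\Delta$. $\quad\top^*R$: $\mathcal G;\Gamma\vdash w:\top^*;\Delta$ if $E(\mathcal G)\vdash w=\epsilon$. - The usual rules $\land L,\land R,\to L,\to R$ at a fixed label $w$. - $*L$: $\mathcal G;\Gamma;z:A*B\vdash\Delta$ from $\mathcal G;(x,y\triangleright z);\Gamma;x:A;y:B\vdash\Delta$, with $x,y$ distinct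 label variables not in the conclusion. - $*R$: $\mathcal G;(x,y\triangleright z');\Gamma\vdash z:A*B;\Delta$ from $\mathcal G;(x,y\triangleright z');\Gamma\vdash x:A;z:A*B;\Delta$ and $\mathcal G;(x,y\triangleright z');\Gamma\vdash y:B;z:A*B;\Delta$, if $E(\mathcal G)\vdash z=z'$. - $-\!*L$: $\mathcal G;(x,y'\triangleright z);\Gamma;y:A\mathbin{-\!*}B\vdash\Delta$ from $\mathcal G;(x,y'\triangleright z);\Gamma;y:A\mathbin{-\!*}B\vdash x:A;\Delta$ and $\mathcal G;(x,y'\triangleright z);\Gamma;y:A\mathbin{-\!*}B;z:B\vdash\Delta$, if $E(\mathcal G)\vdash y=y'$. - $-\!*R$: $\mathcal G;\Gamma\vdash z:A\mathbin{-\!*}B;\Delta$ from $\mathcal G;(x,z\triangleright y);\Gamma;x:A\vdash y:B;\Delta$, with $x,y$ distinct label variables not in the conclusion. - $NEq$: $\mathcal G;x\neq y;\Gamma\vdash\Delta$ if $E(\mathcal G)\vdash x=y$. $\quad EM$: $\mathcal G;\Gamma\vdash\Delta$ from $\mathcal G;x=y;\Gamma\vdash\Delta$ and $\mathcal G;x\neq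 y;\Gamma\vdash\Delta$. - Structural rules, in which the listed atoms are added to those of the conclusion, going from conclusion to premise: $E$: given $(x,y\triangleright z)$ and $E(\mathcal G)\vdash y=\epsilon$, add $x=z$. $U$: add $(x,\epsilon\triangleright x)$. $Com$: given $(x,y\triangleright z)$, add $(y,x\triangleright z)$. $A$: given $(u,y\triangleright x),(v,w\triangleright y')$ and $E(\mathcal G)\vdash y=y'$, add $(z,w\triangleright x),(u,v\triangleright z)$, with $z$ a label variable not in the conclusion. $C$: given $(x,y\triangleright z),(x',w\triangleright z')$, $E(\mathcal G)\vdash x=x'$ and $E(\mathcal G)\vdash z=z'$, add $y=w$. $P$: given $(w,x\triangleright y),(w',x'\triangleright z)$, $E(\mathcal G)\vdash w=w'$ and $E(\mathcal G)\vdash x=x'$, add $y=z$. A formula $F$ is *(cut-free) provable in $LS_{PASL}$* if, for an arbitrary label $w\neq\epsilon$, the sequent $\vdash w:F$ (with no relational atoms and nothing else) is derivable by these rules. **Corollary (Completeness).** Every formula $F$ that is unprovable in $LS_{PASL}$ is not PASL-valid; contrapositively, if $F$ is PASL-valid, then $F$ is (cut-free) provable in $LS_{PASL}$. -/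

import Mathlib

universe u v

namespace PASL

/-- A separation algebra on `H`: a partial, cancellative, commutative monoid.
`op a b = none` means that the composition of `a` and `b` is undefined; the equations of
`op_comm` and `op_assoc` are Kleene equations (both sides undefined, or both defined and equal). -/
structure SeparationAlgebra (H : Type u) where
  /-- the partial composition -/
  op : H → H → Option H
  /-- the unit -/
  unit : H
  op_unit : ∀ h, op h unit = some h
  op_comm : ∀ a b, op a b = op b a
  op_assoc : ∀ a b c, ((op a b).bind fun d => op d c) = ((op b c).bind fun d => op a d)
  op_cancel : ∀ a b c d, op a b = some d → op a c = some d → b = c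

/-- Formulae of propositional abstract separation logic over the propositional variables `Var`.
(Negation and disjunction are derived connectives.) -/
inductive Formula (Var : Type v) : Type v
  /-- propositional variable -/
  | var (p : Var) : Formula Var
  /-- additive truth `⊤` -/
  | top : Formula Var
  /-- additive falsity `⊥` -/
  | bot : Formula Var
  /-- multiplicative truth `⊤*` (`emp`) -/
  | emp : Formula Var
  /-- additive conjunction `A ∧ B` -/
  | and (A B : Formula Var) : Formula Var
  /-- additive implication `A → B` -/
  | imp (A B : Formula Var) : Formula Var
  /-- separating conjunction `A * B` -/
  | star (A B : Formula Var) : Formula Var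
  /-- separating implication (magic wand) `A -* B` -/
  | wand (A B : Formula Var) : Formula Var

/-- Truth of a formula at a world `h` of a separation algebra, under a valuation `val`. -/
def Forces {H : Type u} {Var : Type v} (M : SeparationAlgebra H) (val : Var → Set H) :
    H → Formula Var → Prop
  | h, .var p => h ∈ val p
  | _, .top => True
  | _, .bot => False
  | h, .emp => h = M.unit
  | h, .and A B => Forces M val h A ∧ Forces M val h B
  | h, .imp A B => Forces M val h A → Forces M val h B
  | h, .star A B => ∃ a b, M.op a b = some h ∧ Forces M val a A ∧ Forces M val b B
  | h, .wand A B => ∀ a c, M.op a h = some c → Forces M val a A → Forces M val c B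

/-- A formula is PASL-valid if it is true at every world of every separation algebra
under every valuation. -/
def Valid {Var : Type v} (F : Formula Var) : Prop :=
  ∀ (H : Type u) (M : SeparationAlgebra H) (val : Var → Set H) (h : H), Forces M val h F

/-- Labels: the constant `ε` and countably many label variables. -/
inductive Label : Type
  | eps : Label
  | var (n : ℕ) : Label

/-- Relational atoms: `(x, y ▷ z)`, `x = y` and `x ≠ y`. -/
inductive RelAtom : Type
  | comp (x y z : Label) : RelAtom
  | eq (x y : Label) : RelAtom
  | ne (x y : Label) : RelAtom

/-- The label `l` occurs in a relational atom. -/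
def RelAtom.Mentions (l : Label) : RelAtom → Prop
  | .comp x y z => l = x ∨ l = y ∨ l = z
  | .eq x y => l = x ∨ l = y
  | .ne x y => l = x ∨ l = y

/-- The judgment `E(G) ⊢ x = y`: the equation is in the reflexive, symmetric and transitive
closure of the equality atoms of `G`. -/
inductive EqJudgment (G : Set RelAtom) : Label → Label → Prop
  | ax {x y : Label} : RelAtom.eq x y ∈ G → EqJudgment G x y
  | refl (x : Label) : EqJudgment G x x
  | symm {x y : Label} : EqJudgment G x y → EqJudgment G y x
  | trans {x y z : Label} : EqJudgment G x y → EqJudgment G y z → EqJudgment G x z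

/-- A labelled formula `w : A`. -/
abbrev LFormula (Var : Type v) : Type v := Label × Formula Var

/-- The label `l` does not occur in the sequent `G; Γ ⊢ Δ`. -/
def Fresh {Var : Type v} (l : Label) (G : Set RelAtom) (Γ Δ : Set (LFormula Var)) : Prop :=
  (∀ r ∈ G, ¬ r.Mentions l) ∧ (∀ f ∈ Γ, f.1 ≠ l) ∧ (∀ f ∈ Δ, f.1 ≠ l)

/-- Cut-free derivability of the labelled sequent `G; Γ ⊢ Δ` in `LS_PASL`. Sequents are built from
sets, so contraction is implicit; every sequent in a derivation of a finite sequent is finite.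
There is no cut rule. Labels introduced as fresh are label variables (never `ε`), are pairwise
distinct, and do not occur in the conclusion. -/
inductive Derivable {Var : Type v} :
    Set RelAtom → Set (LFormula Var) → Set (LFormula Var) → Prop
  -- Identity
  | id {G Γ Δ} {w w' : Label} {p : Var} :
      EqJudgment G w w' →
      Derivable G (insert (w, .var p) Γ) (insert (w', .var p) Δ)
  -- Logical rules
  | botL {G Γ Δ} {w : Label} :
      Derivable G (insert (w, .bot) Γ) Δ
  | topR {G Γ Δ} {w : Label} :
      Derivable G Γ (insert (w, .top) Δ)
  | empL {G Γ Δ} {w : Label} :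
      Derivable (insert (.eq w .eps) G) Γ Δ →
      Derivable G (insert (w, .emp) Γ) Δ
  | empR {G Γ Δ} {w : Label} :
      EqJudgment G w .eps →
      Derivable G Γ (insert (w, .emp) Δ)
  | andL {G Γ Δ} {w : Label} {A B : Formula Var} :
      Derivable G (insert (w, A) (insert (w, B) Γ)) Δ →
      Derivable G (insert (w, .and A B) Γ) Δ
  | andR {G Γ Δ} {w : Label} {A B : Formula Var} :
      Derivable G Γ (insert (w, A) Δ) →
      Derivable G Γ (insert (w, B) Δ) →
      Derivable G Γ (insert (w, .and A B) Δ)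
  | impL {G Γ Δ} {w : Label} {A B : Formula Var} :
      Derivable G Γ (insert (w, A) Δ) →
      Derivable G (insert (w, B) Γ) Δ →
      Derivable G (insert (w, .imp A B) Γ) Δ
  | impR {G Γ Δ} {w : Label} {A B : Formula Var} :
      Derivable G (insert (w, A) Γ) (insert (w, B) Δ) →
      Derivable G Γ (insert (w, .imp A B) Δ)
  | starL {G Γ Δ} {z : Label} {A B : Formula Var} {x y : ℕ} :
      x ≠ y →
      Fresh (.var x) G (insert (z, .star A B) Γ) Δ →
      Fresh (.var y) G (insert (z, .star A B) Γ) Δ →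
      Derivable (insert (.comp (.var x) (.var y) z) G)
        (insert (.var x, A) (insert (.var y, B) Γ)) Δ →
      Derivable G (insert (z, .star A B) Γ) Δ
  | starR {G Γ Δ} {x y z z' : Label} {A B : Formula Var} :
      EqJudgment G z z' →
      Derivable (insert (.comp x y z') G) Γ (insert (x, A) (insert (z, .star A B) Δ)) →
      Derivable (insert (.comp x y z') G) Γ (insert (y, B) (insert (z, .star A B) Δ)) →
      Derivable (insert (.comp x y z') G) Γ (insert (z, .star A B) Δ)
  | wandL {G Γ Δ} {x y y' z : Label} {A B : Formula Var} :
      EqJudgment G y y' →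
      Derivable (insert (.comp x y' z) G) (insert (y, .wand A B) Γ) (insert (x, A) Δ) →
      Derivable (insert (.comp x y' z) G) (insert (z, B) (insert (y, .wand A B) Γ)) Δ →
      Derivable (insert (.comp x y' z) G) (insert (y, .wand A B) Γ) Δ
  | wandR {G Γ Δ} {z : Label} {A B : Formula Var} {x y : ℕ} :
      x ≠ y →
      Fresh (.var x) G Γ (insert (z, .wand A B) Δ) →
      Fresh (.var y) G Γ (insert (z, .wand A B) Δ) →
      Derivable (insert (.comp (.var x) z (.var y)) G)
        (insert (.var x, A) Γ) (insert (.var y, B) Δ) →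
      Derivable G Γ (insert (z, .wand A B) Δ)
  -- Rules for equality and inequality atoms
  | neq {G Γ Δ} {x y : Label} :
      EqJudgment G x y →
      Derivable (insert (.ne x y) G) Γ Δ
  | em {G Γ Δ} (x y : Label) :
      Derivable (insert (.eq x y) G) Γ Δ →
      Derivable (insert (.ne x y) G) Γ Δ →
      Derivable G Γ Δ
  -- Structural rules for separation algebras: identity (`E` and `U`)
  | ruleE {G Γ Δ} {x y z : Label} :
      EqJudgment G y .eps →
      Derivable (insert (.eq x z) (insert (.comp x y z) G)) Γ Δ →
      Derivable (insert (.comp x y z) G) Γ Δ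
  | ruleU {G Γ Δ} (x : Label) :
      Derivable (insert (.comp x .eps x) G) Γ Δ →
      Derivable G Γ Δ
  -- Commutativity
  | ruleCom {G Γ Δ} {x y z : Label} :
      Derivable (insert (.comp y x z) (insert (.comp x y z) G)) Γ Δ →
      Derivable (insert (.comp x y z) G) Γ Δ
  -- Associativity
  | ruleA {G Γ Δ} {u v w x y y' : Label} {z : ℕ} :
      EqJudgment G y y' →
      Fresh (.var z) (insert (.comp u y x) (insert (.comp v w y') G)) Γ Δ →
      Derivable (insert (.comp (.var z) w x) (insert (.comp u v (.var z))
        (insert (.comp u y x) (insert (.comp v w y') G)))) Γ Δ →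
      Derivable (insert (.comp u y x) (insert (.comp v w y') G)) Γ Δ
  -- Cancellativity
  | ruleC {G Γ Δ} {x x' y w z z' : Label} :
      EqJudgment G x x' →
      EqJudgment G z z' →
      Derivable (insert (.eq y w) (insert (.comp x y z) (insert (.comp x' w z') G))) Γ Δ →
      Derivable (insert (.comp x y z) (insert (.comp x' w z') G)) Γ Δ
  -- Partial-determinism
  | ruleP {G Γ Δ} {w w' x x' y z : Label} :
      EqJudgment G w w' →
      EqJudgment G x x' →
      Derivable (insert (.eq y z) (insert (.comp w x y) (insert (.comp w' x' z) G))) Γ Δ →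
      Derivable (insert (.comp w x y) (insert (.comp w' x' z) G)) Γ Δ

/-- A formula `F` is (cut-free) provable in `LS_PASL` if the sequent `⊢ w : F` is cut-free
derivable for an arbitrary label `w ≠ ε`. -/
def Provable {Var : Type v} (F : Formula Var) : Prop :=
  ∀ w : Label, w ≠ .eps → Derivable ∅ ∅ {(w, F)}

end PASL

/-!
A finite underivable sequent is extended to a Hintikka sequent, one that is closed under the rules
read upwards, and a Hintikka sequent is its own countermodel: the worlds are the labels modulo the
derivable equations, composition is read off from the ternary atoms, and a variable holds at the
worlds where it occurs on the left.

The Hintikka sequent is the union of a generic increasing sequence of finite underivable sequents.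
Such a sequence settles each of countably many goals: either one of its members meets the goal, or
the members from some point on have no underivable extension that does. A rule applied backwards
yields an underivable extension at every stage, so its goal is met. This replaces a schedule of
rule applications, and it makes do with the countably many subformulae of the given sequent, so
there may be uncountably many variables.
-/

namespace PASL

open Filter Order Set

/-! ### Deciding sequences in a preorder -/

theorem exists_monotone_seq_deciding {P ι : Type*} [Preorder P] [Countable ι] (Q : ι → Set P)
    (p : P) :
    ∃ s : ℕ → P, s 0 = p ∧ Monotone s ∧
      ∀ i, (∃ n, s n ∈ Q i) ∨ ∀ᶠ n in atTop, ∀ q ≥ s n, q ∉ Q i := by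
  let _ := Encodable.ofCountable ι
  let 𝒟 (i : ι) : Cofinal P :=
    { carrier := {q | q ∈ Q i ∨ ∀ r ≥ q, r ∉ Q i}
      isCofinal := fun q => by
        by_cases h : ∃ r ≥ q, r ∈ Q i
        · obtain ⟨r, hqr, hr⟩ := h
          exact ⟨r, .inl hr, hqr⟩
        · exact ⟨q, .inr fun r hqr hr => h ⟨r, hqr, hr⟩, le_rfl⟩ }
  have hmono := sequenceOfCofinals.monotone p 𝒟
  refine ⟨sequenceOfCofinals p 𝒟, rfl, hmono, fun i => ?_⟩
  rcases sequenceOfCofinals.encode_mem p 𝒟 i with hmet | hunmet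
  · exact .inl ⟨_, hmet⟩
  · exact .inr (eventually_atTop.mpr ⟨_, fun n hn q hq => hunmet q ((hmono hn).trans hq)⟩)

/-! ### Constructions of separation algebras -/

section SeparationAlgebra

universe w

variable {H : Type u} {Var : Type v}

/-- The relational presentation of a separation algebra: `R a b c` says that `c` is the composite
of `a` and `b`, and `e` is the unit. -/
structure IsSeparationRel (R : H → H → H → Prop) (e : H) : Prop where
  unit (a : H) : R a e a
  comm {a b c : H} : R a b c → R b a c
  unique {a b c d : H} : R a b c → R a b d → c = d
  assoc {a b c bc abc : H} : R b c bc → R a bc abc → ∃ ab, R a b ab ∧ R ab c abc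
  cancel {a b c d : H} : R a b d → R a c d → b = c

/-- The partial binary operation with a given graph. For a relation that is not functional it
chooses one of the possible values. -/
noncomputable def partialOp (R : H → H → H → Prop) (a b : H) : Option H :=
  open Classical in if h : ∃ c, R a b c then some h.choose else none

namespace IsSeparationRel

variable {R : H → H → H → Prop} {e : H}

theorem partialOp_eq_some_iff (hR : IsSeparationRel R e) {a b c : H} :
    partialOp R a b = some c ↔ R a b c := by
  unfold partialOp
  split_ifs with h
  · rw [Option.some.injEq]
    exact ⟨fun hc => hc ▸ h.choose_spec, hR.unique h.choose_spec⟩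
  · exact ⟨nofun, fun hc => absurd ⟨c, hc⟩ h⟩

/-- The separation algebra presented by a ternary relation. -/
noncomputable def toSeparationAlgebra (hR : IsSeparationRel R e) : SeparationAlgebra H where
  op := partialOp R
  unit := e
  op_unit a := hR.partialOp_eq_some_iff.mpr (hR.unit a)
  op_comm a b := by
    ext c
    rw [hR.partialOp_eq_some_iff, hR.partialOp_eq_some_iff]
    exact ⟨hR.comm, hR.comm⟩
  op_assoc a b c := by
    ext abc
    simp only [Option.bind_eq_some_iff, hR.partialOp_eq_some_iff]
    constructor
    · rintro ⟨ab, hab, habc⟩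
      obtain ⟨bc, hbc, habc⟩ := hR.assoc (hR.comm hab) (hR.comm habc)
      exact ⟨bc, hR.comm hbc, hR.comm habc⟩
    · rintro ⟨bc, hbc, habc⟩
      exact hR.assoc hbc habc
  op_cancel a b c d hb hc :=
    hR.cancel (hR.partialOp_eq_some_iff.mp hb) (hR.partialOp_eq_some_iff.mp hc)

end IsSeparationRel

/-- The copy of a separation algebra in a higher universe. -/
def SeparationAlgebra.ulift (M : SeparationAlgebra H) : SeparationAlgebra (ULift.{w} H) where
  op a b := (M.op a.down b.down).map ULift.up
  unit := ⟨M.unit⟩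
  op_unit a := by simp only [M.op_unit, Option.map_some]
  op_comm a b := by rw [M.op_comm]
  op_assoc a b c := by
    simpa only [Option.bind_map, Option.map_bind, Function.comp_def] using
      congrArg (Option.map ULift.up) (M.op_assoc a.down b.down c.down)
  op_cancel := by
    rintro ⟨a⟩ ⟨b⟩ ⟨c⟩ ⟨d⟩ hb hc
    simp only [Option.map_eq_some_iff, ULift.up.injEq, exists_eq_right] at hb hc ⊢
    exact M.op_cancel a b c d hb hc

theorem SeparationAlgebra.ulift_op_eq_some_iff (M : SeparationAlgebra H) {a b c : H} :
    M.ulift.{u, w}.op ⟨a⟩ ⟨b⟩ = some ⟨c⟩ ↔ M.op a b = some c := by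
  simp only [ulift, Option.map_eq_some_iff, ULift.up.injEq, exists_eq_right]

theorem forces_ulift_iff (M : SeparationAlgebra H) (val : Var → Set H) {h : H} {A : Formula Var} :
    Forces M.ulift.{u, w} (fun p => ULift.down ⁻¹' val p) ⟨h⟩ A ↔ Forces M val h A := by
  induction A generalizing h with
  | var | top | bot => exact Iff.rfl
  | emp => simp only [Forces, SeparationAlgebra.ulift, ULift.up.injEq]
  | and A B ihA ihB => exact and_congr ihA ihB
  | imp A B ihA ihB => exact imp_congr ihA ihB
  | star A B ihA ihB | wand A B ihA ihB =>
    simp only [Forces, ULift.exists, ULift.forall, M.ulift_op_eq_some_iff, ihA, ihB]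

theorem Valid.of_ulift {F : Formula Var} (hF : Valid.{max u w} F) : Valid.{u} F :=
  fun _ M val h => (forces_ulift_iff.{u, v, w} M val).mp (hF _ M.ulift _ ⟨h⟩)

end SeparationAlgebra

/-! ### The separation algebra of a saturated set of relational atoms -/

section World

variable {G : Set RelAtom}

/-- Closure of a set of relational atoms under the structural rules, read upwards. -/
structure IsSaturated (G : Set RelAtom) : Prop where
  unit (x : Label) : .comp x .eps x ∈ G
  comm {x y z : Label} : .comp x y z ∈ G → .comp y x z ∈ G
  unique {w w' x x' y z : Label} : .comp w x y ∈ G → .comp w' x' z ∈ G →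
    EqJudgment G w w' → EqJudgment G x x' → EqJudgment G y z
  assoc {u v w x y y' : Label} : .comp v w y' ∈ G → .comp u y x ∈ G → EqJudgment G y y' →
    ∃ z, .comp u v z ∈ G ∧ .comp z w x ∈ G
  cancel {x x' y w z z' : Label} : .comp x y z ∈ G → .comp x' w z' ∈ G →
    EqJudgment G x x' → EqJudgment G z z' → EqJudgment G y w

/-- The setoid of labels modulo the equations derivable from `G`. -/
def eqSetoid (G : Set RelAtom) : Setoid Label where
  r := EqJudgment G
  iseqv := ⟨.refl, .symm, .trans⟩

/-- The worlds of the canonical model: labels modulo the equations derivable from `G`. -/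
abbrev World (G : Set RelAtom) : Type := Quotient (eqSetoid G)

/-- The world named by a label. -/
abbrev World.mk (G : Set RelAtom) (x : Label) : World G := Quotient.mk (eqSetoid G) x

/-- Composition of worlds, as a relation: some ternary atom of `G` between representatives. -/
def World.Comp (G : Set RelAtom) (a b c : World G) : Prop :=
  ∃ x y z, .comp x y z ∈ G ∧ World.mk G x = a ∧ World.mk G y = b ∧ World.mk G z = c

theorem World.comp_mk {x y z : Label} (h : .comp x y z ∈ G) :
    World.Comp G (.mk G x) (.mk G y) (.mk G z) :=
  ⟨x, y, z, h, rfl, rfl, rfl⟩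

theorem IsSaturated.isSeparationRel (hG : IsSaturated G) :
    IsSeparationRel (World.Comp G) (.mk G .eps) where
  unit a := by
    induction a using Quotient.inductionOn with
    | h x => exact World.comp_mk (hG.unit x)
  comm := by
    rintro _ _ _ ⟨x, y, z, h, rfl, rfl, rfl⟩
    exact World.comp_mk (hG.comm h)
  unique := by
    rintro _ _ _ _ ⟨w, x, y, h, rfl, rfl, rfl⟩ ⟨w', x', z, h', hw, hx, rfl⟩
    exact Quotient.sound (hG.unique h h' (Quotient.exact hw.symm) (Quotient.exact hx.symm))
  assoc := by
    rintro _ _ _ _ _ ⟨v, w, y', h, rfl, rfl, rfl⟩ ⟨u, y, x, h', rfl, hy, rfl⟩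
    obtain ⟨z, hz, hz'⟩ := hG.assoc h h' (Quotient.exact hy)
    exact ⟨.mk G z, World.comp_mk hz, World.comp_mk hz'⟩
  cancel := by
    rintro _ _ _ _ ⟨x, y, z, h, rfl, rfl, rfl⟩ ⟨x', w, z', h', hx, rfl, hz⟩
    exact Quotient.sound (hG.cancel h h' (Quotient.exact hx.symm) (Quotient.exact hz.symm))

end World

/-! ### Hintikka sequents -/

section Hintikka

variable {Var : Type v} {G : Set RelAtom} {Γ Δ : Set (LFormula Var)}

/-- A Hintikka sequent: no rule closes it, and it is closed under the structural and logical rules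
read upwards. -/
structure IsHintikka (G : Set RelAtom) (Γ Δ : Set (LFormula Var)) : Prop
    extends IsSaturated G where
  var_notMem_right {w w' : Label} {p : Var} :
    (w, .var p) ∈ Γ → EqJudgment G w w' → (w', .var p) ∉ Δ
  bot_notMem_left {w : Label} : (w, .bot) ∉ Γ
  top_notMem_right {w : Label} : (w, .top) ∉ Δ
  emp_left {w : Label} : (w, .emp) ∈ Γ → EqJudgment G w .eps
  emp_right {w : Label} : (w, .emp) ∈ Δ → ¬ EqJudgment G w .eps
  and_left {w : Label} {A B : Formula Var} : (w, .and A B) ∈ Γ → (w, A) ∈ Γ ∧ (w, B) ∈ Γ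
  and_right {w : Label} {A B : Formula Var} : (w, .and A B) ∈ Δ → (w, A) ∈ Δ ∨ (w, B) ∈ Δ
  imp_left {w : Label} {A B : Formula Var} : (w, .imp A B) ∈ Γ → (w, A) ∈ Δ ∨ (w, B) ∈ Γ
  imp_right {w : Label} {A B : Formula Var} : (w, .imp A B) ∈ Δ → (w, A) ∈ Γ ∧ (w, B) ∈ Δ
  star_left {z : Label} {A B : Formula Var} : (z, .star A B) ∈ Γ →
    ∃ x y, .comp x y z ∈ G ∧ (x, A) ∈ Γ ∧ (y, B) ∈ Γ
  star_right {x y z z' : Label} {A B : Formula Var} : (z, .star A B) ∈ Δ → .comp x y z' ∈ G →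
    EqJudgment G z z' → (x, A) ∈ Δ ∨ (y, B) ∈ Δ
  wand_left {x y y' z : Label} {A B : Formula Var} : (y, .wand A B) ∈ Γ → .comp x y' z ∈ G →
    EqJudgment G y y' → (x, A) ∈ Δ ∨ (z, B) ∈ Γ
  wand_right {z : Label} {A B : Formula Var} : (z, .wand A B) ∈ Δ →
    ∃ x y, .comp x z y ∈ G ∧ (x, A) ∈ Γ ∧ (y, B) ∈ Δ

namespace IsHintikka

/-- The separation algebra of the canonical model of a Hintikka sequent. -/
noncomputable def algebra (h : IsHintikka G Γ Δ) : SeparationAlgebra (World G) :=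
  h.isSeparationRel.toSeparationAlgebra

theorem algebra_op_eq_some_iff (h : IsHintikka G Γ Δ) {a b c : World G} :
    h.algebra.op a b = some c ↔ World.Comp G a b c :=
  h.isSeparationRel.partialOp_eq_some_iff

/-- The valuation of the canonical model, read off from the antecedent. -/
def valuation (G : Set RelAtom) (Γ : Set (LFormula Var)) (p : Var) : Set (World G) :=
  World.mk G '' {w | (w, .var p) ∈ Γ}

theorem forces_and_not_forces (h : IsHintikka G Γ Δ) (w : Label) (A : Formula Var) :
    ((w, A) ∈ Γ → Forces h.algebra (valuation G Γ) (.mk G w) A) ∧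
      ((w, A) ∈ Δ → ¬ Forces h.algebra (valuation G Γ) (.mk G w) A) := by
  induction A generalizing w with
  | var p =>
    refine ⟨fun hl => ⟨w, hl, rfl⟩, fun hr => ?_⟩
    rintro ⟨w', hl, hw⟩
    exact h.var_notMem_right hl (Quotient.exact hw) hr
  | top => exact ⟨fun _ => trivial, fun hr => absurd hr h.top_notMem_right⟩
  | bot => exact ⟨fun hl => absurd hl h.bot_notMem_left, fun _ => id⟩
  | emp =>
    exact ⟨fun hl => Quotient.sound (h.emp_left hl),
      fun hr hw => h.emp_right hr (Quotient.exact hw)⟩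
  | and A B ihA ihB =>
    refine ⟨fun hl => (h.and_left hl).imp (ihA w).1 (ihB w).1, fun hr ⟨hA, hB⟩ => ?_⟩
    exact (h.and_right hr).elim ((ihA w).2 · hA) ((ihB w).2 · hB)
  | imp A B ihA ihB =>
    refine ⟨fun hl hA => ?_, fun hr hAB => ?_⟩
    · exact (h.imp_left hl).elim (fun hA' => absurd hA ((ihA w).2 hA')) (ihB w).1
    · obtain ⟨hA, hB⟩ := h.imp_right hr
      exact (ihB w).2 hB (hAB ((ihA w).1 hA))
  | star A B ihA ihB =>
    constructor
    · intro hl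
      obtain ⟨x, y, hxy, hA, hB⟩ := h.star_left hl
      exact ⟨_, _, h.algebra_op_eq_some_iff.mpr (World.comp_mk hxy), (ihA x).1 hA, (ihB y).1 hB⟩
    · rintro hr ⟨a, b, hab, hA, hB⟩
      obtain ⟨x, y, z, hxy, rfl, rfl, hz⟩ := h.algebra_op_eq_some_iff.mp hab
      exact (h.star_right hr hxy (Quotient.exact hz.symm)).elim ((ihA x).2 · hA) ((ihB y).2 · hB)
  | wand A B ihA ihB =>
    constructor
    · intro hl a c hac hA
      obtain ⟨x, y, z, hxy, rfl, hy, rfl⟩ := h.algebra_op_eq_some_iff.mp hac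
      exact (h.wand_left hl hxy (Quotient.exact hy.symm)).elim
        (fun hA' => absurd hA ((ihA x).2 hA')) (ihB z).1
    · intro hr hAB
      obtain ⟨x, y, hxy, hA, hB⟩ := h.wand_right hr
      exact (ihB y).2 hB
        (hAB _ _ (h.algebra_op_eq_some_iff.mpr (World.comp_mk hxy)) ((ihA x).1 hA))

theorem not_valid_of_mem_right (h : IsHintikka G Γ Δ) {w : Label} {F : Formula Var}
    (hF : (w, F) ∈ Δ) : ¬ Valid.{0} F :=
  fun hvalid => (h.forces_and_not_forces w F).2 hF (hvalid _ _ _ _)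

end IsHintikka

end Hintikka

/-! ### Subformulae and fresh labels -/

section Subformulas

variable {Var : Type v}

/-- The subformulae of a formula, itself included. -/
def Formula.subformulas : Formula Var → Set (Formula Var)
  | .var p => {.var p}
  | .top => {.top}
  | .bot => {.bot}
  | .emp => {.emp}
  | .and A B => insert (.and A B) (A.subformulas ∪ B.subformulas)
  | .imp A B => insert (.imp A B) (A.subformulas ∪ B.subformulas)
  | .star A B => insert (.star A B) (A.subformulas ∪ B.subformulas)
  | .wand A B => insert (.wand A B) (A.subformulas ∪ B.subformulas)

theorem Formula.self_mem_subformulas (A : Formula Var) : A ∈ A.subformulas := by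
  cases A with
  | var | top | bot | emp => exact mem_singleton _
  | and | imp | star | wand => exact mem_insert _ _

theorem Formula.countable_subformulas (A : Formula Var) : A.subformulas.Countable := by
  induction A with
  | var | top | bot | emp => exact countable_singleton _
  | and _ _ ihA ihB | imp _ _ ihA ihB | star _ _ ihA ihB | wand _ _ ihA ihB =>
    exact (ihA.union ihB).insert _

theorem Formula.subformulas_subset {A B : Formula Var} (h : B ∈ A.subformulas) :
    B.subformulas ⊆ A.subformulas := by
  induction A with
  | var | top | bot | emp => rw [mem_singleton_iff.mp h]
  | and _ _ ihA ihB | imp _ _ ihA ihB | star _ _ ihA ihB | wand _ _ ihA ihB =>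
    rcases h with rfl | h | h
    · exact subset_rfl
    · exact (ihA h).trans (subset_union_left.trans (subset_insert _ _))
    · exact (ihB h).trans (subset_union_right.trans (subset_insert _ _))

/-- Closure of a set of formulae under immediate subformulae. -/
structure IsSubformulaClosed (Φ : Set (Formula Var)) : Prop where
  and {A B : Formula Var} : .and A B ∈ Φ → A ∈ Φ ∧ B ∈ Φ
  imp {A B : Formula Var} : .imp A B ∈ Φ → A ∈ Φ ∧ B ∈ Φ
  star {A B : Formula Var} : .star A B ∈ Φ → A ∈ Φ ∧ B ∈ Φ
  wand {A B : Formula Var} : .wand A B ∈ Φ → A ∈ Φ ∧ B ∈ Φ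

theorem isSubformulaClosed_biUnion_subformulas (Ψ : Set (Formula Var)) :
    IsSubformulaClosed (⋃ A ∈ Ψ, A.subformulas) := by
  have hsub {A B C : Formula Var} (hC : C ∈ ⋃ A ∈ Ψ, A.subformulas)
      (hAB : A.subformulas ∪ B.subformulas ⊆ C.subformulas) :
      A ∈ ⋃ A ∈ Ψ, A.subformulas ∧ B ∈ ⋃ A ∈ Ψ, A.subformulas := by
    obtain ⟨D, hD, hCD⟩ := mem_iUnion₂.mp hC
    have hABD := hAB.trans (Formula.subformulas_subset hCD)
    exact ⟨mem_biUnion hD (hABD (.inl A.self_mem_subformulas)),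
      mem_biUnion hD (hABD (.inr B.self_mem_subformulas))⟩
  exact ⟨(hsub · (subset_insert _ _)), (hsub · (subset_insert _ _)),
    (hsub · (subset_insert _ _)), (hsub · (subset_insert _ _))⟩

theorem Label.var_injective : Function.Injective Label.var :=
  fun _ _ => Label.var.inj

instance : Countable Label := by
  have hsurj : Function.Surjective fun o : Option ℕ => o.elim Label.eps Label.var
    | .eps => ⟨none, rfl⟩
    | .var n => ⟨some n, rfl⟩
  exact hsurj.countable

theorem RelAtom.finite_mentions (r : RelAtom) : {l | r.Mentions l}.Finite := by
  cases r with
  | comp x y z => exact toFinite {x, y, z}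
  | eq x y | ne x y => exact toFinite {x, y}

variable {G : Set RelAtom} {Γ Δ : Set (LFormula Var)}

theorem finite_not_fresh (hG : G.Finite) (hΓ : Γ.Finite) (hΔ : Δ.Finite) :
    {l | ¬ Fresh l G Γ Δ}.Finite := by
  have hfin : ((⋃ r ∈ G, {l | r.Mentions l}) ∪ (Prod.fst '' Γ ∪ Prod.fst '' Δ)).Finite :=
    (hG.biUnion fun r _ => r.finite_mentions).union ((hΓ.image _).union (hΔ.image _))
  refine hfin.subset fun l hl => ?_
  by_contra hmem
  simp only [mem_union, mem_iUnion₂, mem_image, not_or, not_exists, not_and] at hmem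
  exact hl ⟨fun r hr hrl => hmem.1 r hr hrl, hmem.2⟩

theorem exists_fresh (hG : G.Finite) (hΓ : Γ.Finite) (hΔ : Δ.Finite) :
    ∃ x y : ℕ, x ≠ y ∧ Fresh (.var x) G Γ Δ ∧ Fresh (.var y) G Γ Δ := by
  have hfin := (finite_not_fresh hG hΓ hΔ).preimage Label.var_injective.injOn
  obtain ⟨x, hx, y, hy, hxy⟩ := hfin.infinite_compl.nontrivial
  exact ⟨x, y, hxy, not_not.mp hx, not_not.mp hy⟩

end Subformulas

/-! ### Open sequents -/

/-- A finite underivable sequent: an open leaf of a proof search. -/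
structure OpenSequent (Var : Type v) where
  /-- the relational atoms -/
  atoms : Set RelAtom
  /-- the antecedent -/
  left : Set (LFormula Var)
  /-- the succedent -/
  right : Set (LFormula Var)
  finite_atoms : atoms.Finite
  finite_left : left.Finite
  finite_right : right.Finite
  not_derivable : ¬ Derivable atoms left right

namespace OpenSequent

variable {Var : Type v} {T : OpenSequent Var} {A B : Formula Var}
  {u v w w' x x' y y' z z' : Label}

instance : Preorder (OpenSequent Var) where
  le S T := S.atoms ⊆ T.atoms ∧ S.left ⊆ T.left ∧ S.right ⊆ T.right
  le_refl _ := ⟨subset_rfl, subset_rfl, subset_rfl⟩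
  le_trans _ _ _ h k := ⟨h.1.trans k.1, h.2.1.trans k.2.1, h.2.2.trans k.2.2⟩

theorem exists_ge_insert_atom {r : RelAtom}
    (h : ¬ Derivable (insert r T.atoms) T.left T.right) : ∃ U ≥ T, r ∈ U.atoms :=
  ⟨⟨_, _, _, T.finite_atoms.insert r, T.finite_left, T.finite_right, h⟩,
    ⟨subset_insert _ _, subset_rfl, subset_rfl⟩, mem_insert _ _⟩

theorem exists_ge_insert_left {f : LFormula Var}
    (h : ¬ Derivable T.atoms (insert f T.left) T.right) : ∃ U ≥ T, f ∈ U.left :=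
  ⟨⟨_, _, _, T.finite_atoms, T.finite_left.insert f, T.finite_right, h⟩,
    ⟨subset_rfl, subset_insert _ _, subset_rfl⟩, mem_insert _ _⟩

theorem exists_ge_insert_right {f : LFormula Var}
    (h : ¬ Derivable T.atoms T.left (insert f T.right)) : ∃ U ≥ T, f ∈ U.right :=
  ⟨⟨_, _, _, T.finite_atoms, T.finite_left, T.finite_right.insert f, h⟩,
    ⟨subset_rfl, subset_rfl, subset_insert _ _⟩, mem_insert _ _⟩

theorem var_notMem_right {p : Var} (h : (w, .var p) ∈ T.left) (hw : EqJudgment T.atoms w w') :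
    (w', .var p) ∉ T.right := fun hr =>
  T.not_derivable (insert_eq_of_mem h ▸ insert_eq_of_mem hr ▸ .id hw)

theorem bot_notMem_left : (w, .bot) ∉ T.left := fun h =>
  T.not_derivable (insert_eq_of_mem h ▸ .botL)

theorem top_notMem_right : (w, .top) ∉ T.right := fun h =>
  T.not_derivable (insert_eq_of_mem h ▸ .topR)

theorem emp_notMem_right (hw : EqJudgment T.atoms w .eps) : (w, .emp) ∉ T.right := fun h =>
  T.not_derivable (insert_eq_of_mem h ▸ .empR hw)

theorem exists_ge_emp_left (h : (w, .emp) ∈ T.left) : ∃ U ≥ T, .eq w .eps ∈ U.atoms :=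
  exists_ge_insert_atom fun d => T.not_derivable (insert_eq_of_mem h ▸ .empL d)

theorem exists_ge_and_left (h : (w, .and A B) ∈ T.left) :
    ∃ U ≥ T, (w, A) ∈ U.left ∧ (w, B) ∈ U.left := by
  have hd : ¬ Derivable T.atoms (insert (w, A) (insert (w, B) T.left)) T.right := fun d =>
    T.not_derivable (insert_eq_of_mem h ▸ .andL d)
  exact ⟨⟨_, _, _, T.finite_atoms, (T.finite_left.insert _).insert _, T.finite_right, hd⟩,
    ⟨subset_rfl, (subset_insert _ _).trans (subset_insert _ _), subset_rfl⟩,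
    mem_insert _ _, mem_insert_of_mem _ (mem_insert _ _)⟩

theorem exists_ge_and_right (h : (w, .and A B) ∈ T.right) :
    (∃ U ≥ T, (w, A) ∈ U.right) ∨ ∃ U ≥ T, (w, B) ∈ U.right := by
  have hd : ¬ (Derivable T.atoms T.left (insert (w, A) T.right) ∧
      Derivable T.atoms T.left (insert (w, B) T.right)) := fun d =>
    T.not_derivable (insert_eq_of_mem h ▸ .andR d.1 d.2)
  exact (not_and_or.mp hd).imp exists_ge_insert_right exists_ge_insert_right

theorem exists_ge_imp_left (h : (w, .imp A B) ∈ T.left) :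
    (∃ U ≥ T, (w, A) ∈ U.right) ∨ ∃ U ≥ T, (w, B) ∈ U.left := by
  have hd : ¬ (Derivable T.atoms T.left (insert (w, A) T.right) ∧
      Derivable T.atoms (insert (w, B) T.left) T.right) := fun d =>
    T.not_derivable (insert_eq_of_mem h ▸ .impL d.1 d.2)
  exact (not_and_or.mp hd).imp exists_ge_insert_right exists_ge_insert_left

theorem exists_ge_imp_right (h : (w, .imp A B) ∈ T.right) :
    ∃ U ≥ T, (w, A) ∈ U.left ∧ (w, B) ∈ U.right := by
  have hd : ¬ Derivable T.atoms (insert (w, A) T.left) (insert (w, B) T.right) := fun d =>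
    T.not_derivable (insert_eq_of_mem h ▸ .impR d)
  exact ⟨⟨_, _, _, T.finite_atoms, T.finite_left.insert _, T.finite_right.insert _, hd⟩,
    ⟨subset_rfl, subset_insert _ _, subset_insert _ _⟩, mem_insert _ _, mem_insert _ _⟩

theorem exists_ge_star_left (h : (z, .star A B) ∈ T.left) :
    ∃ U ≥ T, ∃ x y, .comp x y z ∈ U.atoms ∧ (x, A) ∈ U.left ∧ (y, B) ∈ U.left := by
  obtain ⟨x, y, hxy, hx, hy⟩ := exists_fresh T.finite_atoms T.finite_left T.finite_right
  have hd : ¬ Derivable (insert (.comp (.var x) (.var y) z) T.atoms)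
      (insert (.var x, A) (insert (.var y, B) T.left)) T.right := fun d =>
    T.not_derivable (insert_eq_of_mem h ▸
      .starL hxy ((insert_eq_of_mem h).symm ▸ hx) ((insert_eq_of_mem h).symm ▸ hy) d)
  exact ⟨⟨_, _, _, T.finite_atoms.insert _, (T.finite_left.insert _).insert _, T.finite_right, hd⟩,
    ⟨subset_insert _ _, (subset_insert _ _).trans (subset_insert _ _), subset_rfl⟩,
    _, _, mem_insert _ _, mem_insert _ _, mem_insert_of_mem _ (mem_insert _ _)⟩

theorem exists_ge_star_right (h : (z, .star A B) ∈ T.right) (hxy : .comp x y z' ∈ T.atoms)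
    (hz : EqJudgment T.atoms z z') :
    (∃ U ≥ T, (x, A) ∈ U.right) ∨ ∃ U ≥ T, (y, B) ∈ U.right := by
  have hG := insert_eq_of_mem hxy
  have hΔ := insert_eq_of_mem h
  have hd : ¬ (Derivable T.atoms T.left (insert (x, A) T.right) ∧
      Derivable T.atoms T.left (insert (y, B) T.right)) := fun ⟨dA, dB⟩ =>
    T.not_derivable (hG ▸ hΔ ▸ .starR hz (by rwa [hG, hΔ]) (by rwa [hG, hΔ]))
  exact (not_and_or.mp hd).imp exists_ge_insert_right exists_ge_insert_right

theorem exists_ge_wand_left (h : (y, .wand A B) ∈ T.left) (hxy : .comp x y' z ∈ T.atoms)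
    (hy : EqJudgment T.atoms y y') :
    (∃ U ≥ T, (x, A) ∈ U.right) ∨ ∃ U ≥ T, (z, B) ∈ U.left := by
  have hG := insert_eq_of_mem hxy
  have hΓ := insert_eq_of_mem h
  have hd : ¬ (Derivable T.atoms T.left (insert (x, A) T.right) ∧
      Derivable T.atoms (insert (z, B) T.left) T.right) := fun ⟨dA, dB⟩ =>
    T.not_derivable (hG ▸ hΓ ▸ .wandL hy (by rwa [hG, hΓ]) (by rwa [hG, hΓ]))
  exact (not_and_or.mp hd).imp exists_ge_insert_right exists_ge_insert_left

theorem exists_ge_wand_right (h : (z, .wand A B) ∈ T.right) :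
    ∃ U ≥ T, ∃ x y, .comp x z y ∈ U.atoms ∧ (x, A) ∈ U.left ∧ (y, B) ∈ U.right := by
  obtain ⟨x, y, hxy, hx, hy⟩ := exists_fresh T.finite_atoms T.finite_left T.finite_right
  have hd : ¬ Derivable (insert (.comp (.var x) z (.var y)) T.atoms)
      (insert (.var x, A) T.left) (insert (.var y, B) T.right) := fun d =>
    T.not_derivable (insert_eq_of_mem h ▸
      .wandR hxy ((insert_eq_of_mem h).symm ▸ hx) ((insert_eq_of_mem h).symm ▸ hy) d)
  exact ⟨⟨_, _, _, T.finite_atoms.insert _, T.finite_left.insert _, T.finite_right.insert _, hd⟩,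
    ⟨subset_insert _ _, subset_insert _ _, subset_insert _ _⟩,
    _, _, mem_insert _ _, mem_insert _ _, mem_insert _ _⟩

theorem exists_ge_unit (T : OpenSequent Var) (x : Label) : ∃ U ≥ T, .comp x .eps x ∈ U.atoms :=
  exists_ge_insert_atom fun d => T.not_derivable (.ruleU x d)

theorem exists_ge_comm (h : .comp x y z ∈ T.atoms) : ∃ U ≥ T, .comp y x z ∈ U.atoms :=
  exists_ge_insert_atom fun d => T.not_derivable <| insert_eq_of_mem h ▸
    .ruleCom ((insert_eq_of_mem h).symm ▸ d)

theorem exists_ge_unique (h : .comp w x y ∈ T.atoms) (h' : .comp w' x' z ∈ T.atoms)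
    (hw : EqJudgment T.atoms w w') (hx : EqJudgment T.atoms x x') :
    ∃ U ≥ T, .eq y z ∈ U.atoms :=
  have hG := (congrArg _ (insert_eq_of_mem h')).trans (insert_eq_of_mem h)
  exists_ge_insert_atom fun d => T.not_derivable (hG ▸ .ruleP hw hx (hG.symm ▸ d))

theorem exists_ge_cancel (h : .comp x y z ∈ T.atoms) (h' : .comp x' w z' ∈ T.atoms)
    (hx : EqJudgment T.atoms x x') (hz : EqJudgment T.atoms z z') :
    ∃ U ≥ T, .eq y w ∈ U.atoms :=
  have hG := (congrArg _ (insert_eq_of_mem h')).trans (insert_eq_of_mem h)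
  exists_ge_insert_atom fun d => T.not_derivable (hG ▸ .ruleC hx hz (hG.symm ▸ d))

theorem exists_ge_assoc (h : .comp v w y' ∈ T.atoms) (h' : .comp u y x ∈ T.atoms)
    (hy : EqJudgment T.atoms y y') :
    ∃ U ≥ T, ∃ z, .comp u v z ∈ U.atoms ∧ .comp z w x ∈ U.atoms := by
  obtain ⟨z, -, -, hz, -⟩ := exists_fresh T.finite_atoms T.finite_left T.finite_right
  have hG := (congrArg _ (insert_eq_of_mem h)).trans (insert_eq_of_mem h')
  have hd : ¬ Derivable (insert (.comp (.var z) w x) (insert (.comp u v (.var z)) T.atoms))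
      T.left T.right := fun d =>
    T.not_derivable (hG ▸ .ruleA hy (hG.symm ▸ hz) (hG.symm ▸ d))
  exact ⟨⟨_, _, _, (T.finite_atoms.insert _).insert _, T.finite_left, T.finite_right, hd⟩,
    ⟨(subset_insert _ _).trans (subset_insert _ _), subset_rfl, subset_rfl⟩,
    _, mem_insert_of_mem _ (mem_insert _ _), mem_insert _ _⟩

end OpenSequent

/-! ### Generic sequences and their limits -/

section Generic

variable {Var : Type v} {Φ : Set (Formula Var)} {s : ℕ → OpenSequent Var}

/-- The properties of open sequents that a generic sequence decides: containing an atom or a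
labelled formula of `Φ`, or having labels that witness `z : A * B` on the left, `z : A -* B` on the
right, or the associativity of `u`, `v`, `w` with composite `x`. -/
inductive Goal (Φ : Set (Formula Var)) : Type v
  | comp (x y z : Label) : Goal Φ
  | eq (x y : Label) : Goal Φ
  | left (w : Label) (A : Φ) : Goal Φ
  | right (w : Label) (A : Φ) : Goal Φ
  | star (z : Label) (A B : Φ) : Goal Φ
  | wand (z : Label) (A B : Φ) : Goal Φ
  | assoc (u v w x : Label) : Goal Φ

namespace Goal

/-- The open sequents that have the property named by a goal. -/
def IsMet : Goal Φ → OpenSequent Var → Prop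
  | comp x y z, T => .comp x y z ∈ T.atoms
  | eq x y, T => .eq x y ∈ T.atoms
  | left w A, T => (w, A.1) ∈ T.left
  | right w A, T => (w, A.1) ∈ T.right
  | star z A B, T => ∃ x y, .comp x y z ∈ T.atoms ∧ (x, A.1) ∈ T.left ∧ (y, B.1) ∈ T.left
  | wand z A B, T => ∃ x y, .comp x z y ∈ T.atoms ∧ (x, A.1) ∈ T.left ∧ (y, B.1) ∈ T.right
  | assoc u v w x, T => ∃ z, .comp u v z ∈ T.atoms ∧ .comp z w x ∈ T.atoms

/-- The constructor, the labels and the formulae of a goal, to count the goals. -/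
def code : Goal Φ → ℕ × List Label × List Φ
  | comp x y z => (0, [x, y, z], [])
  | eq x y => (1, [x, y], [])
  | left w A => (2, [w], [A])
  | right w A => (3, [w], [A])
  | star z A B => (4, [z], [A, B])
  | wand z A B => (5, [z], [A, B])
  | assoc u v w x => (6, [u, v, w, x], [])

theorem code_injective : Function.Injective (code (Φ := Φ)) := by
  intro g g' h
  cases g <;> cases g' <;> simp_all [code]

instance [Countable Φ] : Countable (Goal Φ) :=
  code_injective.countable

end Goal

/-- An increasing sequence of open sequents is generic if every goal over `Φ` is met by one of its
members or, from some point on, by no open extension of its members. -/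
structure IsGeneric (Φ : Set (Formula Var)) (s : ℕ → OpenSequent Var) : Prop where
  monotone : Monotone s
  decides (g : Goal Φ) : (∃ n, g.IsMet (s n)) ∨ ∀ᶠ n in atTop, ∀ T ≥ s n, ¬ g.IsMet T

theorem exists_isGeneric (hΦ : Φ.Countable) (S : OpenSequent Var) :
    ∃ s, s 0 = S ∧ IsGeneric Φ s := by
  have := hΦ.to_subtype
  obtain ⟨s, hs, hmono, hdec⟩ := exists_monotone_seq_deciding (fun g : Goal Φ => {T | g.IsMet T}) S
  exact ⟨s, hs, hmono, hdec⟩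

/-- The relational atoms of the limit of a sequence. -/
def limitAtoms (s : ℕ → OpenSequent Var) : Set RelAtom :=
  {r | ∃ n, r ∈ (s n).atoms}

/-- The antecedent of the limit of a sequence, restricted to the formulae in `Φ`: a generic
sequence decides nothing about the others. -/
def limitLeft (Φ : Set (Formula Var)) (s : ℕ → OpenSequent Var) : Set (LFormula Var) :=
  {f | f.2 ∈ Φ ∧ ∃ n, f ∈ (s n).left}

/-- The succedent of the limit of a sequence, restricted like `limitLeft`. -/
def limitRight (Φ : Set (Formula Var)) (s : ℕ → OpenSequent Var) : Set (LFormula Var) :=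
  {f | f.2 ∈ Φ ∧ ∃ n, f ∈ (s n).right}

section Monotone

variable (hs : Monotone s)
include hs

theorem eventually_mem_atoms {r : RelAtom} (h : r ∈ limitAtoms s) :
    ∀ᶠ n in atTop, r ∈ (s n).atoms :=
  eventually_atTop.mpr (h.imp fun _ hr _ hn => (hs hn).1 hr)

theorem eventually_mem_left {f : LFormula Var} (h : f ∈ limitLeft Φ s) :
    ∀ᶠ n in atTop, f ∈ (s n).left :=
  eventually_atTop.mpr (h.2.imp fun _ hf _ hn => (hs hn).2.1 hf)

theorem eventually_mem_right {f : LFormula Var} (h : f ∈ limitRight Φ s) :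
    ∀ᶠ n in atTop, f ∈ (s n).right :=
  eventually_atTop.mpr (h.2.imp fun _ hf _ hn => (hs hn).2.2 hf)

theorem eventually_eqJudgment {x y : Label} (h : EqJudgment (limitAtoms s) x y) :
    ∀ᶠ n in atTop, EqJudgment (s n).atoms x y := by
  induction h with
  | ax h => exact (eventually_mem_atoms hs h).mono fun _ => .ax
  | refl x => exact .of_forall fun _ => .refl x
  | symm _ ih => exact ih.mono fun _ => .symm
  | trans _ _ ih₁ ih₂ => exact (ih₁.and ih₂).mono fun _ h => h.1.trans h.2

end Monotone

namespace IsGeneric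

theorem exists_isMet_or (hs : IsGeneric Φ s) (g₁ g₂ : Goal Φ)
    (h : ∀ᶠ n in atTop, (∃ T ≥ s n, g₁.IsMet T) ∨ ∃ T ≥ s n, g₂.IsMet T) :
    (∃ n, g₁.IsMet (s n)) ∨ ∃ n, g₂.IsMet (s n) := by
  refine (hs.decides g₁).imp_right fun h₁ => (hs.decides g₂).resolve_right fun h₂ => ?_
  obtain ⟨n, hn, h₁, h₂⟩ := (h.and (h₁.and h₂)).exists
  exact hn.elim (fun ⟨T, hT, hg⟩ => h₁ T hT hg) (fun ⟨T, hT, hg⟩ => h₂ T hT hg)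

theorem exists_isMet (hs : IsGeneric Φ s) (g : Goal Φ)
    (h : ∀ᶠ n in atTop, ∃ T ≥ s n, g.IsMet T) : ∃ n, g.IsMet (s n) :=
  or_self_iff.mp (hs.exists_isMet_or g g (h.mono fun _ => .inl))

theorem isSaturated_limitAtoms (hs : IsGeneric Φ s) : IsSaturated (limitAtoms s) where
  unit x := hs.exists_isMet (.comp x .eps x) (.of_forall fun n => (s n).exists_ge_unit x)
  comm h := hs.exists_isMet (.comp _ _ _)
    ((eventually_mem_atoms hs.monotone h).mono fun _ => OpenSequent.exists_ge_comm)
  unique {w w' x x' y z} h h' hw hx := by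
    refine .ax (hs.exists_isMet (.eq y z) ?_)
    filter_upwards [eventually_mem_atoms hs.monotone h, eventually_mem_atoms hs.monotone h',
      eventually_eqJudgment hs.monotone hw, eventually_eqJudgment hs.monotone hx]
      with n using OpenSequent.exists_ge_unique
  assoc {u v w x y y'} h h' hy := by
    have hmet : ∃ n, (Goal.assoc u v w x : Goal Φ).IsMet (s n) := by
      refine hs.exists_isMet _ ?_
      filter_upwards [eventually_mem_atoms hs.monotone h, eventually_mem_atoms hs.monotone h',
        eventually_eqJudgment hs.monotone hy] with n using OpenSequent.exists_ge_assoc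
    obtain ⟨n, z, hz, hz'⟩ := hmet
    exact ⟨z, ⟨n, hz⟩, ⟨n, hz'⟩⟩
  cancel {x x' y w z z'} h h' hx hz := by
    refine .ax (hs.exists_isMet (.eq y w) ?_)
    filter_upwards [eventually_mem_atoms hs.monotone h, eventually_mem_atoms hs.monotone h',
      eventually_eqJudgment hs.monotone hx, eventually_eqJudgment hs.monotone hz]
      with n using OpenSequent.exists_ge_cancel

section Connectives

variable {A B : Formula Var}

theorem limit_and_left (hs : IsGeneric Φ s) (hA : A ∈ Φ) (hB : B ∈ Φ) {w : Label}
    (h : (w, .and A B) ∈ limitLeft Φ s) : (w, A) ∈ limitLeft Φ s ∧ (w, B) ∈ limitLeft Φ s := by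
  have hext := (eventually_mem_left hs.monotone h).mono fun _ => OpenSequent.exists_ge_and_left
  exact ⟨⟨hA, hs.exists_isMet (.left w ⟨A, hA⟩)
      (hext.mono fun _ ⟨U, hU, h⟩ => ⟨U, hU, h.1⟩)⟩,
    ⟨hB, hs.exists_isMet (.left w ⟨B, hB⟩) (hext.mono fun _ ⟨U, hU, h⟩ => ⟨U, hU, h.2⟩)⟩⟩

theorem limit_and_right (hs : IsGeneric Φ s) (hA : A ∈ Φ) (hB : B ∈ Φ) {w : Label}
    (h : (w, .and A B) ∈ limitRight Φ s) :
    (w, A) ∈ limitRight Φ s ∨ (w, B) ∈ limitRight Φ s :=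
  (hs.exists_isMet_or (.right w ⟨A, hA⟩) (.right w ⟨B, hB⟩)
    ((eventually_mem_right hs.monotone h).mono fun _ => OpenSequent.exists_ge_and_right)).imp
    (⟨hA, ·⟩) (⟨hB, ·⟩)

theorem limit_imp_left (hs : IsGeneric Φ s) (hA : A ∈ Φ) (hB : B ∈ Φ) {w : Label}
    (h : (w, .imp A B) ∈ limitLeft Φ s) : (w, A) ∈ limitRight Φ s ∨ (w, B) ∈ limitLeft Φ s :=
  (hs.exists_isMet_or (.right w ⟨A, hA⟩) (.left w ⟨B, hB⟩)
    ((eventually_mem_left hs.monotone h).mono fun _ => OpenSequent.exists_ge_imp_left)).imp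
    (⟨hA, ·⟩) (⟨hB, ·⟩)

theorem limit_imp_right (hs : IsGeneric Φ s) (hA : A ∈ Φ) (hB : B ∈ Φ) {w : Label}
    (h : (w, .imp A B) ∈ limitRight Φ s) :
    (w, A) ∈ limitLeft Φ s ∧ (w, B) ∈ limitRight Φ s := by
  have hext := (eventually_mem_right hs.monotone h).mono fun _ => OpenSequent.exists_ge_imp_right
  exact ⟨⟨hA, hs.exists_isMet (.left w ⟨A, hA⟩)
      (hext.mono fun _ ⟨U, hU, h⟩ => ⟨U, hU, h.1⟩)⟩,
    ⟨hB, hs.exists_isMet (.right w ⟨B, hB⟩) (hext.mono fun _ ⟨U, hU, h⟩ => ⟨U, hU, h.2⟩)⟩⟩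

theorem limit_star_left (hs : IsGeneric Φ s) (hA : A ∈ Φ) (hB : B ∈ Φ) {z : Label}
    (h : (z, .star A B) ∈ limitLeft Φ s) :
    ∃ x y, .comp x y z ∈ limitAtoms s ∧ (x, A) ∈ limitLeft Φ s ∧ (y, B) ∈ limitLeft Φ s := by
  obtain ⟨n, x, y, hxy, hxA, hyB⟩ := hs.exists_isMet (.star z ⟨A, hA⟩ ⟨B, hB⟩)
    ((eventually_mem_left hs.monotone h).mono fun _ => OpenSequent.exists_ge_star_left)
  exact ⟨x, y, ⟨n, hxy⟩, ⟨hA, n, hxA⟩, hB, n, hyB⟩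

theorem limit_star_right (hs : IsGeneric Φ s) (hA : A ∈ Φ) (hB : B ∈ Φ) {x y z z' : Label}
    (h : (z, .star A B) ∈ limitRight Φ s) (hxy : .comp x y z' ∈ limitAtoms s)
    (hz : EqJudgment (limitAtoms s) z z') :
    (x, A) ∈ limitRight Φ s ∨ (y, B) ∈ limitRight Φ s := by
  refine (hs.exists_isMet_or (.right x ⟨A, hA⟩) (.right y ⟨B, hB⟩) ?_).imp (⟨hA, ·⟩) (⟨hB, ·⟩)
  filter_upwards [eventually_mem_right hs.monotone h, eventually_mem_atoms hs.monotone hxy,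
    eventually_eqJudgment hs.monotone hz] with n using OpenSequent.exists_ge_star_right

theorem limit_wand_left (hs : IsGeneric Φ s) (hA : A ∈ Φ) (hB : B ∈ Φ) {x y y' z : Label}
    (h : (y, .wand A B) ∈ limitLeft Φ s) (hxy : .comp x y' z ∈ limitAtoms s)
    (hy : EqJudgment (limitAtoms s) y y') :
    (x, A) ∈ limitRight Φ s ∨ (z, B) ∈ limitLeft Φ s := by
  refine (hs.exists_isMet_or (.right x ⟨A, hA⟩) (.left z ⟨B, hB⟩) ?_).imp (⟨hA, ·⟩) (⟨hB, ·⟩)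
  filter_upwards [eventually_mem_left hs.monotone h, eventually_mem_atoms hs.monotone hxy,
    eventually_eqJudgment hs.monotone hy] with n using OpenSequent.exists_ge_wand_left

theorem limit_wand_right (hs : IsGeneric Φ s) (hA : A ∈ Φ) (hB : B ∈ Φ) {z : Label}
    (h : (z, .wand A B) ∈ limitRight Φ s) :
    ∃ x y, .comp x z y ∈ limitAtoms s ∧ (x, A) ∈ limitLeft Φ s ∧ (y, B) ∈ limitRight Φ s := by
  obtain ⟨n, x, y, hxy, hxA, hyB⟩ := hs.exists_isMet (.wand z ⟨A, hA⟩ ⟨B, hB⟩)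
    ((eventually_mem_right hs.monotone h).mono fun _ => OpenSequent.exists_ge_wand_right)
  exact ⟨x, y, ⟨n, hxy⟩, ⟨hA, n, hxA⟩, hB, n, hyB⟩

end Connectives

theorem isHintikka_limit (hs : IsGeneric Φ s) (hΦ : IsSubformulaClosed Φ) :
    IsHintikka (limitAtoms s) (limitLeft Φ s) (limitRight Φ s) where
  toIsSaturated := hs.isSaturated_limitAtoms
  var_notMem_right hl hw hr :=
    have ⟨_, hl, hr, hw⟩ := ((eventually_mem_left hs.monotone hl).and
      ((eventually_mem_right hs.monotone hr).and (eventually_eqJudgment hs.monotone hw))).exists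
    OpenSequent.var_notMem_right hl hw hr
  bot_notMem_left := fun ⟨_, _, hl⟩ => OpenSequent.bot_notMem_left hl
  top_notMem_right := fun ⟨_, _, hr⟩ => OpenSequent.top_notMem_right hr
  emp_left hl := .ax <| hs.exists_isMet (.eq _ .eps)
    ((eventually_mem_left hs.monotone hl).mono fun _ => OpenSequent.exists_ge_emp_left)
  emp_right hr hw :=
    have ⟨_, hr, hw⟩ := ((eventually_mem_right hs.monotone hr).and
      (eventually_eqJudgment hs.monotone hw)).exists
    OpenSequent.emp_notMem_right hw hr
  and_left hl := hs.limit_and_left (hΦ.and hl.1).1 (hΦ.and hl.1).2 hl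
  and_right hr := hs.limit_and_right (hΦ.and hr.1).1 (hΦ.and hr.1).2 hr
  imp_left hl := hs.limit_imp_left (hΦ.imp hl.1).1 (hΦ.imp hl.1).2 hl
  imp_right hr := hs.limit_imp_right (hΦ.imp hr.1).1 (hΦ.imp hr.1).2 hr
  star_left hl := hs.limit_star_left (hΦ.star hl.1).1 (hΦ.star hl.1).2 hl
  star_right hr := hs.limit_star_right (hΦ.star hr.1).1 (hΦ.star hr.1).2 hr
  wand_left hl := hs.limit_wand_left (hΦ.wand hl.1).1 (hΦ.wand hl.1).2 hl
  wand_right hr := hs.limit_wand_right (hΦ.wand hr.1).1 (hΦ.wand hr.1).2 hr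

end IsGeneric

theorem exists_isHintikka_of_not_derivable {G : Set RelAtom} {Γ Δ : Set (LFormula Var)}
    (hG : G.Finite) (hΓ : Γ.Finite) (hΔ : Δ.Finite) (h : ¬ Derivable G Γ Δ) :
    ∃ G' Γ' Δ', G ⊆ G' ∧ Γ ⊆ Γ' ∧ Δ ⊆ Δ' ∧ IsHintikka G' Γ' Δ' := by
  let Φ := ⋃ A ∈ Prod.snd '' (Γ ∪ Δ), A.subformulas
  have hΦ : Φ.Countable :=
    ((hΓ.union hΔ).image _).countable.biUnion fun A _ => A.countable_subformulas
  have hmem : ∀ f ∈ Γ ∪ Δ, f.2 ∈ Φ := fun f hf =>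
    mem_biUnion (mem_image_of_mem _ hf) f.2.self_mem_subformulas
  obtain ⟨s, hs₀, hs⟩ := exists_isGeneric hΦ ⟨G, Γ, Δ, hG, hΓ, hΔ, h⟩
  refine ⟨limitAtoms s, limitLeft Φ s, limitRight Φ s, fun r hr => ⟨0, ?_⟩,
    fun f hf => ⟨hmem f (.inl hf), 0, ?_⟩, fun f hf => ⟨hmem f (.inr hf), 0, ?_⟩,
    hs.isHintikka_limit (isSubformulaClosed_biUnion_subformulas _)⟩ <;>
  rwa [hs₀]

theorem derivable_singleton_of_valid {F : Formula Var} (hF : Valid.{0} F) (w : Label) :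
    Derivable ∅ ∅ {(w, F)} := by
  by_contra hd
  obtain ⟨_, _, _, -, -, hΔ, h⟩ := exists_isHintikka_of_not_derivable finite_empty finite_empty
    (finite_singleton (w, F)) hd
  exact h.not_valid_of_mem_right (hΔ rfl) hF

end Generic

end PASL

theorem mainTheorem2 {Var : Type v} (F : PASL.Formula Var) :
    (¬ PASL.Provable F → ¬ PASL.Valid.{u} F) ∧ (PASL.Valid.{u} F → PASL.Provable F) := by
  have hcomplete (hF : PASL.Valid.{u} F) : PASL.Provable F := fun w _ =>
    PASL.derivable_singleton_of_valid (PASL.Valid.of_ulift.{0, v, u} hF) w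
  exact ⟨mt hcomplete, hcomplete⟩
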